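/- Let $\mathcal P$ be a finite, totally ordered set of processes and let $\widetilde\Sigma=\{\Sigma_i\}_{i\in\mathcal P}$ be a distributed alphabet, $\Sigma=\bigcup_i\Sigma_i$, $\mathrm{loc}(a)=\{i : a\in\Sigma_i\}$. A trace $t=(E,\le,\lambda)\in TR(\widetilde\Sigma)$ is a finite $\Sigma$-labelled poset in which events $e\lessdot e'$ have labels sharing a process, and events whose labels share a process are comparable. A configuration is a down-closed subset of $E$. An asynchronous automaton $A=(\{S_i\},\{\delta_a\},s_{\mathrm{in}})$ over $\widetilde\Sigma$ has finite non-empty sets $S_i$ of local states, transition functions $\delta_a\colon S_a\to S_a$ (where $S_Q=\prod_{i\in Q}S_i$, $S_a=S_{\mathrm{loc}(a)}$), and an initial global state $s_{\mathrm{in}}\in S_{\mathcal P}$; $\Delta_a\colon S_{\mathcal P}\to S_{\mathcal P}$ is the extension of $\delta_a$ by the identity on the processes outside $\mathrm{loc}(a)$. Its unique run on $t$ is the map $\rho_t$ from configurations to global states with $\rho_t(\emptyset)=s_{\mathrm{in}}$ and $\rho_t(c\cup\{e\})=\Delta_{\lambda(e)}(\rho_t(c))$ whenever $c$ and $c\cup\{e\}$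 are configurations and $e\notin c$. The local and global asynchronous transducers of $A$ keep $(E,\le)$ and relabel each event $e$, with $s=\rho_t({\downarrow}e\setminus\{e\})$: $\chi_A(t)$ has the label $(\lambda(e),s_{\mathrm{loc}(\lambda(e))})$ and $\theta_A(t)$ has the label $(\lambda(e),s)$ at $e$; extended letters are distributed like their $\Sigma$-component. For a configuration $c$ let $\partial_i(c)={\downarrow}(c\cap E_i)$, where $E_i$ is the set of events in which $i$ participates. For $\emptyset\ne Q\subseteq\mathcal P$ let $\mathrm{latest}_{t,Q}(c,j)$ be the least $\ell\in Q$ such that $\partial_j(\partial_k(c))\subseteq\partial_j(\partial_\ell(c))$ for all $k\in Q$. A gossip automaton is an asynchronous automaton $\mathcal G=(\{\Upsilon_i\},\{\nabla_a\},v_{\mathrm{in}})$ over $\widetilde\Sigma$ with functions $\mathrm{gossip}_Q\colon\Upsilon_Q\times\mathcal P\to Q$ such that $\mathrm{latest}_{t,Q}(c,j)=\mathrm{gossip}_Q(v_Q,j)$ for every trace $t$, configuration $c$, process $j$ and non-empty $Q$, where $v$ is the global state of the run of $\mathcal G$ on $t$ at $c$. Given a gossip automaton $\mathcal G$ and an asynchronous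 automaton $A$, put $S^{\mathcal G}_i=\Upsilon_i\times S_{\mathcal P}$ and define $\mathrm{globalstate}_Q\colon S^{\mathcal G}_Q\to S_{\mathcal P}$ by $\mathrm{globalstate}_Q\big((v_k,s_k)_{k\in Q}\big)(i)=s_\ell(i)$ with $\ell=\mathrm{gossip}_Q((v_k)_{k\in Q},i)$. The gossip-augmented automaton $\mathcal G(A)$ has the local states $S^{\mathcal G}_i$ and the initial local states $(v_{\mathrm{in}}(i),s_{\mathrm{in}})$, and its $a$-transition sends $(v_k,s_k)_{k\in\mathrm{loc}(a)}$ to $(v'_k,s')_{k\in\mathrm{loc}(a)}$, where $(v'_k)_k=\nabla_a((v_k)_k)$ and $s'=\Delta_a(\mathrm{globalstate}_{\mathrm{loc}(a)}((v_k,s_k)_k))$. On letters, $\mathrm{globalstate}(a,x)=(a,\mathrm{globalstate}_{\mathrm{loc}(a)}(x))$. For an automaton $A'=(\{Q_i\},\{\delta'_{(a,x)}\},q_{\mathrm{in}})$ reading the local letters $(a,x)$ of $A$, the local cascade product $A\circ_\ell A'$ has local states $S_i\times Q_i$, initial state $(s_{\mathrm{in}},q_{\mathrm{in}})$ and transitions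 $(x,q)\mapsto(\delta_a(x),\delta'_{(a,x)}(q))$. For an automaton $B$ over the alphabet $\Sigma\times S_{\mathcal P}$, the run of the global cascade product $A\circ_g B$ on $t$ is the run of $A$ on $t$ paired with the run of $B$ on $\theta_A(t)$; a set $F$ of pairs of global states accepts $t$ if the pair at the configuration $E$ lies in $F$. **Theorem.** A gossip automaton over $\widetilde\Sigma$ exists. For every gossip automaton $\mathcal G$ over $\widetilde\Sigma$ and every asynchronous automaton $A$ over $\widetilde\Sigma$: 1. For every trace $t=(E,\le,\lambda)\in TR(\widetilde\Sigma)$, if $\chi_{\mathcal G(A)}(t)=(E,\le,\mu)$, then $\theta_A(t)=(E,\le,\nu)$ where $\nu(e)=\mathrm{globalstate}(\mu(e))$ for all $e\in E$. 2. For every asynchronous automaton $B$ over $\Sigma\times S_{\mathcal P}$, let $B'$ be the automaton with the same states that treats a local letter $b$ of $\mathcal G(A)$ as $B$ treats $\mathrm{globalstate}(b)$. Then $\mathcal G(A)\circ_\ell B'$ simulates $A\circ_g B$: there is a map $\pi$ from the global states of $\mathcal G(A)$ to those of $A$ such that, for every trace $t$ and configuration $c$, if the run of $\mathcal G(A)\circ_\ell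 B'$ on $t$ is in the global state $(r,q)$ at $c$, then the run of $A\circ_g B$ on $t$ is in $(\pi(r),q)$ at $c$. In particular, every trace language accepted by $A\circ_g B$ is accepted by $\mathcal G(A)\circ_\ell B'$. -/

import Mathlib

/-! # Traces, asynchronous automata, asynchronous transducers and gossip -/

universe u v w x y z

section Traces

/-- A distributed alphabet over the set `P` of processes: a family `(part i)` of subsets of `α`,
indexed by the processes, whose union is the whole alphabet `α`. -/
structure DistributedAlphabet (P : Type u) (α : Type v) where
  part : P → Set α
  cover : ⋃ i, part i = Set.univ

namespace DistributedAlphabet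

variable {P : Type u} {α : Type v} {β : Type w}

/-- The set of processes that take part in the letter `a`. -/
def loc (S : DistributedAlphabet P α) (a : α) : Set P := {i | a ∈ S.part i}

/-- Dependence of letters: the letters share a process. -/
def Dep (S : DistributedAlphabet P α) (a b : α) : Prop := (S.loc a ∩ S.loc b).Nonempty

theorem loc_nonempty (S : DistributedAlphabet P α) (a : α) : (S.loc a).Nonempty := by
  have h : a ∈ ⋃ i, S.part i := by rw [S.cover]; trivial
  obtain ⟨i, hi⟩ := Set.mem_iUnion.1 h
  exact ⟨i, hi⟩

/-- The alphabet `β` of extended letters, where `b` carries the letter `f b` and is distributed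
like it. -/
def comap (S : DistributedAlphabet P α) (f : β → α) : DistributedAlphabet P β where
  part i := f ⁻¹' S.part i
  cover := by rw [← Set.preimage_iUnion, S.cover, Set.preimage_univ]

end DistributedAlphabet

/-- A trace `(E, ≤, label)` over a distributed alphabet, with underlying finite poset `E`
(finiteness of `E` is an instance argument where traces are used). -/
@[ext]
structure DTrace {P : Type u} {α : Type v} (S : DistributedAlphabet P α)
    (E : Type x) [PartialOrder E] where
  label : E → α
  dep_of_covBy : ∀ e e' : E, e ⋖ e' → S.Dep (label e) (label e')
  comparable_of_dep : ∀ e e' : E, S.Dep (label e) (label e') → e ≤ e' ∨ e' ≤ e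

namespace DTrace

variable {P : Type u} {α : Type v} {S : DistributedAlphabet P α} {E : Type x} [PartialOrder E]

/-- The set `E_i` of events in which process `i` takes part. -/
def procEvents (t : DTrace S E) (i : P) : Set E := {e | i ∈ S.loc (t.label e)}

/-- Configurations of a trace are the lower sets of `E`; this is the event-based transition
relation on them. -/
def EventStep (_t : DTrace S E) (c : LowerSet E) (e : E) (c' : LowerSet E) : Prop :=
  e ∉ c ∧ (c : Set E) ∪ {e} = (c' : Set E)

/-- The action-based transition relation on configurations. -/
def ActionStep (t : DTrace S E) (c : LowerSet E) (a : α) (c' : LowerSet E) : Prop :=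
  ∃ e, t.label e = a ∧ t.EventStep c e c'

/-- The `i`-view of the configuration `c`: the lower set generated by `c ∩ E_i`. -/
def view (t : DTrace S E) (i : P) (c : LowerSet E) : LowerSet E :=
  lowerClosure ((c : Set E) ∩ t.procEvents i)

/-- `l` is the least process of `Q` that has, among the processes of `Q`, the best information
about process `j` at the configuration `c`. -/
def IsLatest [LinearOrder P] (t : DTrace S E) (Q : Set P) (c : LowerSet E) (j l : P) : Prop :=
  IsLeast {l | l ∈ Q ∧ ∀ k ∈ Q, t.view j (t.view k c) ≤ t.view j (t.view l c)} l

end DTrace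

end Traces

section Automata

/-- The `Q`-states of a family of local states. -/
abbrev JointState {P : Type u} (X : P → Type w) (Q : Set P) : Type (max u w) := ∀ i : Q, X i

/-- The extension of a map on `Q`-states to global states. -/
noncomputable def extendMap {P : Type u} {X : P → Type w} (Q : Set P)
    (f : JointState X Q → JointState X Q) (s : ∀ i, X i) : ∀ i, X i :=
  open Classical in fun i => if h : i ∈ Q then f (fun k => s k) ⟨i, h⟩ else s i

/-- A (deterministic) asynchronous automaton over a distributed alphabet. -/
structure AsyncAutomaton {P : Type u} {α : Type v} (S : DistributedAlphabet P α) where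
  State : P → Type w
  finite_state : ∀ i, Finite (State i)
  nonempty_state : ∀ i, Nonempty (State i)
  δ : ∀ a : α, JointState State (S.loc a) → JointState State (S.loc a)
  init : ∀ i, State i

namespace AsyncAutomaton

variable {P : Type u} {α : Type v} {S : DistributedAlphabet P α} {E : Type x} [PartialOrder E]

/-- Global states. -/
abbrev GlobalState (A : AsyncAutomaton.{u, v, w} S) : Type (max u w) := ∀ i, A.State i

/-- The global transition function of the letter `a`. -/
noncomputable def Δ (A : AsyncAutomaton.{u, v, w} S) (a : α) (s : A.GlobalState) : A.GlobalState :=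
  extendMap (S.loc a) (A.δ a) s

/-- `ρ` is a trace run of `A` over `t`. -/
def IsRun (A : AsyncAutomaton.{u, v, w} S) (t : DTrace S E) (ρ : LowerSet E → A.GlobalState) :
    Prop :=
  ρ ⊥ = A.init ∧ ∀ c a c', t.ActionStep c a c' → A.Δ a (ρ c) = ρ c'

theorem delta_comm (A : AsyncAutomaton.{u, v, w} S) {a b : α} (h : ¬ S.Dep a b)
    (s : A.GlobalState) : A.Δ a (A.Δ b s) = A.Δ b (A.Δ a s) := by
  have hd : ∀ i, i ∈ S.loc a → i ∉ S.loc b := fun i ha hb => h ⟨i, ha, hb⟩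
  funext i
  by_cases ha : i ∈ S.loc a
  · have hb := hd i ha
    simp only [Δ, extendMap, ha, hb, dite_true, dite_false]
    congr 1
    funext k
    simp [hd k.1 k.2]
  · by_cases hb : i ∈ S.loc b
    · simp only [Δ, extendMap, ha, hb, dite_true, dite_false]
      congr 1
      funext k
      have : k.1 ∉ S.loc a := fun h' => hd _ h' k.2
      simp [this]
    · simp [Δ, extendMap, ha, hb]

/-- `s` is obtained by executing the events of `c` in some order. Only used to show that trace runs
exist and are unique. -/
inductive Reaches (A : AsyncAutomaton.{u, v, w} S) (t : DTrace S E) :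
    LowerSet E → A.GlobalState → Prop
  | bot : Reaches A t ⊥ A.init
  | step {c c' : LowerSet E} {e : E} {s : A.GlobalState} : t.EventStep c e c' → Reaches A t c s →
      Reaches A t c' (A.Δ (t.label e) s)

theorem reaches_cases (A : AsyncAutomaton.{u, v, w} S) (t : DTrace S E) {c' : LowerSet E}
    {s' : A.GlobalState} (h : A.Reaches t c' s') : (c' = ⊥ ∧ s' = A.init) ∨
      ∃ c e s, t.EventStep c e c' ∧ A.Reaches t c s ∧ s' = A.Δ (t.label e) s := by
  cases h with
  | bot => exact Or.inl ⟨rfl, rfl⟩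
  | step h1 h2 => exact Or.inr ⟨_, _, _, h1, h2, rfl⟩

/-- Removing a maximal event from a configuration. -/
theorem exists_pred (t : DTrace S E) (c : LowerSet E) (e : E) (he : e ∈ c)
    (hm : ∀ y ∈ c, e ≤ y → y = e) : ∃ d : LowerSet E, t.EventStep d e c ∧
      (d : Set E) = (c : Set E) \ {e} := by
  refine ⟨⟨(c : Set E) \ {e}, ?_⟩, ⟨?_, ?_⟩, rfl⟩
  · rintro x y hyx ⟨hx, hxe⟩
    refine ⟨c.lower hyx hx, ?_⟩
    rintro rfl
    exact hxe (hm x hx hyx)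
  · intro h
    exact h.2 rfl
  · exact Set.sdiff_union_of_subset (Set.singleton_subset_iff.2 he)

theorem existsUnique_reaches [Finite E] (A : AsyncAutomaton.{u, v, w} S) (t : DTrace S E) (n : ℕ) :
    ∀ c : LowerSet E, (c : Set E).ncard = n → ∃! s, A.Reaches t c s := by
  have card_step : ∀ {c e c'}, t.EventStep c e c' →
      (c' : Set E).ncard = (c : Set E).ncard + 1 := by
    rintro c e c' ⟨h1, h2⟩
    rw [← h2, Set.union_singleton, Set.ncard_insert_of_notMem h1]
  have maxim : ∀ {c e c'}, t.EventStep c e c' → e ∈ c' ∧ ∀ y ∈ c', e ≤ y → y = e := by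
    rintro c e c' ⟨h1, h2⟩
    refine ⟨?_, ?_⟩
    · change e ∈ (c' : Set E); rw [← h2]; simp
    · intro y hy hle
      have : y ∈ (c : Set E) ∪ {e} := by rw [h2]; exact hy
      rcases this with h | h
      · exact absurd (c.lower hle h) h1
      · exact h
  induction n with
  | zero =>
    intro c hc
    have hc' : c = ⊥ := by
      apply SetLike.coe_injective
      rw [(Set.ncard_eq_zero).1 hc]
      rfl
    subst hc'
    refine ⟨A.init, Reaches.bot, ?_⟩
    intro s hs
    rcases A.reaches_cases t hs with h | ⟨d, e, s1, h1, -, -⟩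
    · exact h.2
    · have := card_step h1
      omega
  | succ n ih =>
    intro c hc
    have hne : (c : Set E).Nonempty := by
      rw [← Set.ncard_pos]; omega
    obtain ⟨e, he⟩ := (Set.toFinite (c : Set E)).exists_maximal hne
    obtain ⟨d, hd, -⟩ := exists_pred t c e he.1 (fun y hy hle => le_antisymm (he.2 hy hle) hle)
    have hdc : (d : Set E).ncard = n := by have := card_step hd; omega
    obtain ⟨s, hs, -⟩ := ih d hdc
    refine ⟨_, Reaches.step hd hs, ?_⟩
    intro s' hs'
    rcases A.reaches_cases t hs' with h | ⟨d', e', s1, h1, h2, rfl⟩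
    · rw [h.1] at hc; simp at hc
    have hdc' : (d' : Set E).ncard = n := by have := card_step h1; omega
    by_cases hee : e' = e
    · subst hee
      have : d' = d := by
        apply SetLike.coe_injective
        have e1 : (d' : Set E) = (c : Set E) \ {e'} := by
          rw [← h1.2]; ext y
          simp only [Set.union_singleton, Set.mem_sdiff, Set.mem_insert_iff, Set.mem_singleton_iff]
          have := h1.1
          constructor
          · intro hy; exact ⟨Or.inr hy, fun h => this (h ▸ hy)⟩
          · rintro ⟨h | h, h'⟩
            · exact absurd h h'
            · exact h
        have e2 : (d : Set E) = (c : Set E) \ {e'} := by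
          rw [← hd.2]; ext y
          simp only [Set.union_singleton, Set.mem_sdiff, Set.mem_insert_iff, Set.mem_singleton_iff]
          have := hd.1
          constructor
          · intro hy; exact ⟨Or.inr hy, fun h => this (h ▸ hy)⟩
          · rintro ⟨h | h, h'⟩
            · exact absurd h h'
            · exact h
        rw [e1, e2]
      subst this
      rw [(ih _ hdc).unique h2 hs]
    · have m1 := maxim hd
      have m2 := maxim h1
      have hnd : ¬ S.Dep (t.label e') (t.label e) := by
        intro h
        rcases t.comparable_of_dep _ _ h with h | h
        · exact hee (m2.2 _ m1.1 h).symm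
        · exact hee (m1.2 _ m2.1 h)
      have he'd : e' ∈ d := by
        have : e' ∈ (d : Set E) ∪ {e} := by rw [hd.2]; exact m2.1
        rcases this with h | h
        · exact h
        · exact absurd h hee
      have hed' : e ∈ d' := by
        have : e ∈ (d' : Set E) ∪ {e'} := by rw [h1.2]; exact m1.1
        rcases this with h | h
        · exact h
        · exact absurd h.symm hee
      have sub : ∀ y ∈ d, y ∈ c := fun y hy => by
        change y ∈ (c : Set E); rw [← hd.2]; exact Or.inl hy
      have sub' : ∀ y ∈ d', y ∈ c := fun y hy => by
        change y ∈ (c : Set E); rw [← h1.2]; exact Or.inl hy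
      obtain ⟨f, hf, hf'⟩ := exists_pred t d e' he'd (fun y hy => m2.2 y (sub y hy))
      obtain ⟨g, hg, hg'⟩ := exists_pred t d' e hed' (fun y hy => m1.2 y (sub' y hy))
      have hfg : f = g := by
        apply SetLike.coe_injective
        rw [hf', hg']
        ext y
        simp only [Set.mem_sdiff, Set.mem_singleton_iff, SetLike.mem_coe]
        constructor
        · rintro ⟨hy, hye'⟩
          refine ⟨?_, fun h => hd.1 (h ▸ hy)⟩
          have : y ∈ (d' : Set E) ∪ {e'} := by rw [h1.2]; exact sub y hy
          rcases this with h | h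
          · exact h
          · exact absurd h hye'
        · rintro ⟨hy, hye⟩
          refine ⟨?_, fun h => h1.1 (h ▸ hy)⟩
          have : y ∈ (d : Set E) ∪ {e} := by rw [hd.2]; exact sub' y hy
          rcases this with h | h
          · exact h
          · exact absurd h hye
      subst hfg
      have hn : n ≠ 0 := by
        rintro rfl
        have : (d : Set E) = ∅ := (Set.ncard_eq_zero).1 hdc
        have h' : e' ∈ (d : Set E) := he'd
        rw [this] at h'
        exact h'
      -- a state reached at the common predecessor
      obtain ⟨q, hq⟩ : ∃ q, A.Reaches t f q := by
        have key : ∀ m, ∀ f : LowerSet E, (f : Set E).ncard = m → ∃ q, A.Reaches t f q := by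
          intro m
          induction m with
          | zero =>
            intro f hf0
            have : f = ⊥ := by
              apply SetLike.coe_injective
              rw [(Set.ncard_eq_zero).1 hf0]; rfl
            subst this
            exact ⟨_, Reaches.bot⟩
          | succ m ihm =>
            intro f hfm
            have hne : (f : Set E).Nonempty := by
              rw [← Set.ncard_pos]; omega
            obtain ⟨e, he⟩ := (Set.toFinite (f : Set E)).exists_maximal hne
            obtain ⟨d, hd, -⟩ :=
              exists_pred t f e he.1 (fun y hy hle => le_antisymm (he.2 hy hle) hle)
            obtain ⟨q, hq⟩ := ihm d (by have := card_step hd; omega)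
            exact ⟨_, Reaches.step hd hq⟩
        exact key _ f rfl
      have r1 := (ih _ hdc).unique hs (Reaches.step hf hq)
      have r2 := (ih _ hdc').unique h2 (Reaches.step hg hq)
      rw [r1, r2]
      exact A.delta_comm hnd q

theorem existsUnique_isRun [Finite E] (A : AsyncAutomaton.{u, v, w} S) (t : DTrace S E) :
    ∃! ρ : LowerSet E → A.GlobalState, A.IsRun t ρ := by
  have H : ∀ c : LowerSet E, ∃! s, A.Reaches t c s := fun c => A.existsUnique_reaches t _ c rfl
  choose ρ hρ hu using H
  refine ⟨ρ, ⟨(hu _ _ Reaches.bot).symm, ?_⟩, ?_⟩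
  · rintro c a c' ⟨e, rfl, h⟩
    exact hu _ _ (Reaches.step h (hρ c))
  · intro ρ' hρ'
    have key : ∀ c s, A.Reaches t c s → ρ' c = s := by
      intro c s h
      induction h with
      | bot => exact hρ'.1
      | step h1 _ ih => rw [← ih]; exact (hρ'.2 _ _ _ ⟨_, rfl, h1⟩).symm
    funext c
    exact key c _ (hρ c)

/-- The unique trace run of `A` over `t`. -/
noncomputable def run [Finite E] (A : AsyncAutomaton.{u, v, w} S) (t : DTrace S E) :
    LowerSet E → A.GlobalState :=
  (A.existsUnique_isRun t).choose

theorem isRun_run [Finite E] (A : AsyncAutomaton.{u, v, w} S) (t : DTrace S E) :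
    A.IsRun t (A.run t) :=
  (A.existsUnique_isRun t).choose_spec.1

/-! ## Asynchronous transducers

Since `LowerSet.Iio e` is the configuration of all events strictly below `e`, it is the
configuration obtained by removing `e` from its down-closure. -/

/-- Letters `(a, s_a)`: a letter together with a joint state of the processes taking part in it. -/
abbrev LocalLetter (A : AsyncAutomaton.{u, v, w} S) : Type (max u v w) :=
  Σ a : α, JointState A.State (S.loc a)

/-- The distributed alphabet of the letters `(a, s_a)`. -/
abbrev localAlphabet (A : AsyncAutomaton.{u, v, w} S) : DistributedAlphabet P A.LocalLetter :=
  S.comap Sigma.fst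

/-- Letters `(a, s)`: a letter together with a global state. -/
abbrev GlobalLetter (A : AsyncAutomaton.{u, v, w} S) : Type (max u v w) := α × A.GlobalState

/-- The distributed alphabet of the letters `(a, s)`. -/
abbrev globalAlphabet (A : AsyncAutomaton.{u, v, w} S) : DistributedAlphabet P A.GlobalLetter :=
  S.comap Prod.fst

/-- The local asynchronous transducer of `A`. -/
noncomputable def localTransducer [Finite E] (A : AsyncAutomaton.{u, v, w} S) (t : DTrace S E) :
    DTrace A.localAlphabet E where
  label e := ⟨t.label e, fun i => A.run t (LowerSet.Iio e) i⟩
  dep_of_covBy := t.dep_of_covBy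
  comparable_of_dep := t.comparable_of_dep

/-- The global asynchronous transducer of `A`. -/
noncomputable def globalTransducer [Finite E] (A : AsyncAutomaton.{u, v, w} S) (t : DTrace S E) :
    DTrace A.globalAlphabet E where
  label e := (t.label e, A.run t (LowerSet.Iio e))
  dep_of_covBy := t.dep_of_covBy
  comparable_of_dep := t.comparable_of_dep

/-! ## The gossip automaton and the gossip-augmented automaton -/

/-- A family of functions that select, from the joint state of a non-empty set `Q` of processes and
a process `j`, a member of `Q`. -/
abbrev GossipFamily (G : AsyncAutomaton.{u, v, y} S) : Type (max u y) :=
  ∀ Q : Set P, Q.Nonempty → JointState G.State Q → P → Q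

/-- `G`, with the functions `gossip`, is a gossip automaton: on every trace and at every
configuration, `gossip` computes from the local states of the processes in `Q` which member of `Q`
has the latest information about `j`. -/
def IsGossip [LinearOrder P] (G : AsyncAutomaton.{u, v, y} S) (gossip : G.GossipFamily) : Prop :=
  ∀ (E : Type x) [PartialOrder E] [Finite E] (t : DTrace S E) (c : LowerSet E)
    (Q : Set P) (hQ : Q.Nonempty) (j : P),
    t.IsLatest Q c j (gossip Q hQ (fun i => G.run t c i) j)

/-- The local states of the gossip-augmented automaton: a local gossip state and a global state
of `A`. -/
abbrev AugState (G : AsyncAutomaton.{u, v, y} S) (A : AsyncAutomaton.{u, v, w} S) (i : P) :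
    Type (max u w y) :=
  G.State i × A.GlobalState

/-- The function `globalstate` on joint states of a non-empty set `Q` of processes: the state of
process `i` is taken from the member of `Q` selected by `gossip`. -/
def globalstateOn (G : AsyncAutomaton.{u, v, y} S) (gossip : G.GossipFamily)
    (A : AsyncAutomaton.{u, v, w} S) (Q : Set P) (hQ : Q.Nonempty)
    (s : JointState (AugState G A) Q) : A.GlobalState :=
  fun i => (s (gossip Q hQ (fun k => (s k).1) i)).2 i

/-- The gossip-augmented automaton of `A`. -/
noncomputable def augment [Finite P] (G : AsyncAutomaton.{u, v, y} S) (gossip : G.GossipFamily)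
    (A : AsyncAutomaton.{u, v, w} S) : AsyncAutomaton.{u, v, max u w y} S where
  State := AugState G A
  finite_state i := by
    have := G.finite_state i
    have := A.finite_state
    infer_instance
  nonempty_state i := ⟨(G.init i, A.init)⟩
  δ a s := fun i =>
    (G.δ a (fun k => (s k).1) i, A.Δ a (globalstateOn G gossip A (S.loc a) (S.loc_nonempty a) s))
  init i := (G.init i, A.init)

/-- The function `globalstate` on letters. -/
def globalstate [Finite P] (G : AsyncAutomaton.{u, v, y} S) (gossip : G.GossipFamily)
    (A : AsyncAutomaton.{u, v, w} S) (b : (augment G gossip A).LocalLetter) : A.GlobalLetter :=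
  (b.1, globalstateOn G gossip A (S.loc b.1) (S.loc_nonempty b.1) b.2)

/-! ## Cascade products -/

/-- The local cascade product. -/
def localCascade (A : AsyncAutomaton.{u, v, w} S)
    (B : AsyncAutomaton.{u, max u v w, z} A.localAlphabet) :
    AsyncAutomaton.{u, v, max w z} S where
  State i := A.State i × B.State i
  finite_state i := by
    have := A.finite_state i
    have := B.finite_state i
    infer_instance
  nonempty_state i := ⟨(A.init i, B.init i)⟩
  δ a s := fun i => (A.δ a (fun k => (s k).1) i,
    B.δ ⟨a, fun k => (s k).1⟩ (fun k => (s k).2) i)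
  init i := (A.init i, B.init i)

/-- The run of the global cascade product of `A` and `B` over `t`: the run of `A` over `t` together
with the run of `B` over the output of the global asynchronous transducer of `A`. -/
noncomputable def globalCascadeRun [Finite E] (A : AsyncAutomaton.{u, v, w} S)
    (B : AsyncAutomaton.{u, max u v w, z} A.globalAlphabet) (t : DTrace S E) (c : LowerSet E) :
    A.GlobalState × B.GlobalState :=
  (A.run t c, B.run (A.globalTransducer t) c)

/-- An automaton `B` reading letters `(a, s)` of `A`, seen as an automaton that reads local letters
of the gossip-augmented automaton, through the relabelling `globalstate`. -/
def viaGlobalstate [Finite P] (G : AsyncAutomaton.{u, v, y} S) (gossip : G.GossipFamily)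
    (A : AsyncAutomaton.{u, v, w} S) (B : AsyncAutomaton.{u, max u v w, z} A.globalAlphabet) :
    AsyncAutomaton.{u, max u v w y, z} (augment G gossip A).localAlphabet where
  State := B.State
  finite_state := B.finite_state
  nonempty_state := B.nonempty_state
  δ b := B.δ (globalstate G gossip A b)
  init := B.init

end AsyncAutomaton

end Automata

/-!
Everything rests on the views `view i c` of the processes at a configuration `c`. Events of one
process form a chain, so `view j (view i c)` is empty or generated by a single event, the last event
of `j` known to `i`, and for each `j` these views are totally ordered.

**Existence of a gossip automaton.** Each process `i` stores a finite label for the last event of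
`k` in `view j (view i c)`, for all `j` and `k`, and the inclusion order of the sets
`view k (view i c)`. By `view_view_le_iff`, processes `i` and `j` can compare their knowledge about
`k` from these orders and from which of their last events coincide. The combinatorial fact behind
this is `exists_mem_view_le`: a maximal element of the intersection of a view with a smaller
configuration is the last event of some process in that configuration.

Coincidence of last events is tested by comparing labels, and finitely many labels are to be reused.
An event gets a label that consists of one of its processes and a name that occurs in none of the
participants' states. If `e < f` share a process and `e` is still the last event of some process in
some view at a configuration containing `f`, then `exists_mem_view_le` shows that the participants
of `f` have `e` among their stored events, so `f` gets a different label
(`view_eq_of_topLabel_eq`). The states are updated correctly because the events below `e` are the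
union of the views of the participants of `e` (`iSup_view_eventStep`), and the view of `k` in this
union is that of the participant with the latest information about `k`.

**Simulation.** The local state of `i` depends only on `view i c` (`run_view`). By induction, in the
augmented automaton each process `i` holds the global state of `A` at `view i c` (`run_augment`).
Taking the component `k` from the process in `Q` with the latest information about `k` gives the
global state at the union of the views of the processes in `Q` (`globalstateOn_view`). For the
participants of an event `e` this union is the set of events below `e`, which gives the label of
`e` under the global transducer. For all processes it is the whole configuration, which gives the
simulation map.
-/

/-! ### Views of configurations -/

namespace DTrace

variable {P : Type u} {α : Type v} {S : DistributedAlphabet P α} {E : Type x} [PartialOrder E]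

theorem mem_view (t : DTrace S E) {i : P} {c : LowerSet E} {x : E} :
    x ∈ t.view i c ↔ ∃ y ∈ c, i ∈ S.loc (t.label y) ∧ x ≤ y := by
  simp only [view, mem_lowerClosure, Set.mem_inter_iff, SetLike.mem_coe, procEvents,
    Set.mem_ofPred_eq, and_assoc]

theorem mem_view_self (t : DTrace S E) {i : P} {c : LowerSet E} {x : E} (hx : x ∈ c)
    (hi : i ∈ S.loc (t.label x)) : x ∈ t.view i c :=
  t.mem_view.2 ⟨x, hx, hi, le_rfl⟩

theorem view_le (t : DTrace S E) (i : P) (c : LowerSet E) : t.view i c ≤ c := by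
  intro x hx
  obtain ⟨y, hy, -, hxy⟩ := t.mem_view.1 hx
  exact c.lower hxy hy

theorem view_mono (t : DTrace S E) (i : P) {c d : LowerSet E} (h : c ≤ d) :
    t.view i c ≤ t.view i d := by
  intro x hx
  obtain ⟨y, hy, hi, hxy⟩ := t.mem_view.1 hx
  exact t.mem_view.2 ⟨y, h hy, hi, hxy⟩

theorem view_view_self (t : DTrace S E) (i : P) (c : LowerSet E) :
    t.view i (t.view i c) = t.view i c := by
  refine le_antisymm (t.view_le _ _) fun x hx => ?_
  obtain ⟨y, hy, hi, hxy⟩ := t.mem_view.1 hx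
  exact t.mem_view.2 ⟨y, t.mem_view_self hy hi, hi, hxy⟩

theorem view_bot (t : DTrace S E) (i : P) : t.view i ⊥ = ⊥ :=
  le_bot_iff.1 (t.view_le i ⊥)

theorem view_le_view_iff (t : DTrace S E) {i : P} {c d : LowerSet E} :
    t.view i c ≤ t.view i d ↔ t.view i c ≤ d :=
  ⟨fun h => h.trans (t.view_le _ _), fun h => by
    rw [← t.view_view_self i c]; exact t.view_mono i h⟩

theorem view_le_total (t : DTrace S E) (j : P) (c d : LowerSet E) :
    t.view j c ≤ t.view j d ∨ t.view j d ≤ t.view j c := by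
  by_contra! h
  obtain ⟨h1, h2⟩ := h
  apply h2
  obtain ⟨x, hx, hxd⟩ := Set.not_subset.1 (show ¬ (t.view j c : Set E) ⊆ t.view j d from h1)
  obtain ⟨y, hy, hj, hxy⟩ := t.mem_view.1 hx
  intro z hz
  obtain ⟨w, hw, hwj, hzw⟩ := t.mem_view.1 hz
  rcases t.comparable_of_dep y w ⟨j, hj, hwj⟩ with h | h
  · exact absurd (t.mem_view.2 ⟨w, hw, hwj, hxy.trans h⟩) hxd
  · exact t.mem_view.2 ⟨y, hy, hj, hzw.trans h⟩

theorem view_Iic (t : DTrace S E) {i : P} {e : E} (hi : i ∈ S.loc (t.label e)) :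
    t.view i (LowerSet.Iic e) = LowerSet.Iic e :=
  le_antisymm (t.view_le _ _) fun _ hx =>
    t.mem_view.2 ⟨e, LowerSet.mem_Iic_iff.2 le_rfl, hi, hx⟩

/-- Since the events of a process form a chain, a view is empty or generated by its last event. -/
theorem view_eq_bot_or_Iic [Finite E] (t : DTrace S E) (j : P) (c : LowerSet E) :
    t.view j c = ⊥ ∨
      ∃ e ∈ c, j ∈ S.loc (t.label e) ∧ t.view j c = LowerSet.Iic e := by
  by_cases hne : ((c : Set E) ∩ t.procEvents j).Nonempty
  · right
    obtain ⟨e, he⟩ := (Set.toFinite _).exists_maximal hne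
    refine ⟨e, he.1.1, he.1.2, le_antisymm ?_ ?_⟩
    · intro x hx
      obtain ⟨y, hy, hj, hxy⟩ := t.mem_view.1 hx
      refine hxy.trans ?_
      rcases t.comparable_of_dep y e ⟨j, hj, he.1.2⟩ with h | h
      · exact h
      · exact he.2 ⟨hy, hj⟩ h
    · intro x hx
      exact t.mem_view.2 ⟨e, he.1.1, he.1.2, hx⟩
  · left
    rw [view, Set.not_nonempty_iff_eq_empty.1 hne, lowerClosure_empty]

theorem eventStep_le {t : DTrace S E} {c c' : LowerSet E} {e : E} (h : t.EventStep c e c') :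
    c ≤ c' := fun x hx => by
  rw [← h.2]; exact Or.inl hx

theorem mem_of_eventStep {t : DTrace S E} {c c' : LowerSet E} {e : E}
    (h : t.EventStep c e c') {x : E} : x ∈ c' ↔ x ∈ c ∨ x = e := by
  change x ∈ (c' : Set E) ↔ _; rw [← h.2]; rfl

theorem Iio_le_of_eventStep {t : DTrace S E} {c c' : LowerSet E} {e : E}
    (h : t.EventStep c e c') : LowerSet.Iio e ≤ c := fun x hx => by
  have hx : x < e := hx
  rcases (mem_of_eventStep h).1 (c'.lower hx.le ((mem_of_eventStep h).2 (Or.inr rfl))) with h | h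
  · exact h
  · exact absurd h hx.ne

theorem eventStep_Iio (t : DTrace S E) (e : E) :
    t.EventStep (LowerSet.Iio e) e (LowerSet.Iic e) := by
  refine ⟨fun h => lt_irrefl e h, ?_⟩
  ext x
  simp [le_iff_eq_or_lt]

theorem eq_bot_or_eventStep [Finite E] (t : DTrace S E) (c : LowerSet E) :
    c = ⊥ ∨ ∃ d e, t.EventStep d e c := by
  by_cases hne : (c : Set E).Nonempty
  · obtain ⟨e, he⟩ := (Set.toFinite (c : Set E)).exists_maximal hne
    obtain ⟨d, hd, -⟩ := AsyncAutomaton.exists_pred t c e he.1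
      (fun y hy hle => le_antisymm (he.2 hy hle) hle)
    exact Or.inr ⟨d, e, hd⟩
  · left
    apply SetLike.coe_injective
    rw [Set.not_nonempty_iff_eq_empty.1 hne]; rfl

theorem lt_of_eventStep {t : DTrace S E} {c c' : LowerSet E} {e : E}
    (h : t.EventStep c e c') : c < c' :=
  lt_of_le_of_ne (eventStep_le h) fun hcc => h.1 (hcc ▸ (mem_of_eventStep h).2 (Or.inr rfl))

theorem _root_.LowerSet.strong_induction [Finite E] {p : LowerSet E → Prop}
    (h : ∀ c, (∀ d < c, p d) → p c) (c : LowerSet E) : p c := by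
  have : Finite (LowerSet E) := Finite.of_injective _ SetLike.coe_injective
  exact WellFoundedLT.induction c h

theorem view_eventStep_of_notMem {t : DTrace S E} {c c' : LowerSet E} {e : E}
    (h : t.EventStep c e c') {i : P} (hi : i ∉ S.loc (t.label e)) :
    t.view i c' = t.view i c := by
  refine le_antisymm (fun x hx => ?_) (t.view_mono i (eventStep_le h))
  obtain ⟨y, hy, hyi, hxy⟩ := t.mem_view.1 hx
  rcases (mem_of_eventStep h).1 hy with h' | rfl
  · exact t.mem_view.2 ⟨y, h', hyi, hxy⟩
  · exact absurd hyi hi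

theorem view_eventStep_of_mem {t : DTrace S E} {c c' : LowerSet E} {e : E}
    (h : t.EventStep c e c') {i : P} (hi : i ∈ S.loc (t.label e)) :
    t.view i c' = LowerSet.Iic e := by
  have hec' : e ∈ c' := (mem_of_eventStep h).2 (Or.inr rfl)
  refine le_antisymm (fun x hx => ?_) fun x hx => t.mem_view.2 ⟨e, hec', hi, hx⟩
  obtain ⟨y, hy, hyi, hxy⟩ := t.mem_view.1 hx
  rcases (mem_of_eventStep h).1 hy with h' | rfl
  · rcases t.comparable_of_dep y e ⟨i, hyi, hi⟩ with h2 | h2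
    · exact hxy.trans h2
    · exact absurd (c.lower h2 h') h.1
  · exact hxy

/-- The events below `e` are what the processes taking part in `e` jointly know before `e`. -/
theorem iSup_view_eventStep [Finite E] {t : DTrace S E} {c c' : LowerSet E} {e : E}
    (h : t.EventStep c e c') :
    ⨆ q ∈ S.loc (t.label e), t.view q c = LowerSet.Iio e := by
  apply le_antisymm
  · refine iSup₂_le fun q hq x hx => ?_
    have h1 : x ∈ LowerSet.Iic e := by
      rw [← view_eventStep_of_mem h hq]; exact t.view_mono q (eventStep_le h) hx
    exact lt_of_le_of_ne h1 fun hxe => h.1 (hxe ▸ t.view_le q c hx)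
  · intro x hx
    have : IsStronglyCoatomic E := by
      have := Fintype.ofFinite E
      infer_instance
    obtain ⟨y, hxy, hye⟩ := exists_le_covBy_of_lt (show x < e from hx)
    obtain ⟨q, hq1, hq2⟩ := t.dep_of_covBy _ _ hye
    refine LowerSet.mem_iSup₂_iff.2 ⟨q, hq2, t.mem_view.2 ⟨y, Iio_le_of_eventStep h hye.lt, hq1, hxy⟩⟩

theorem view_Iio_of_eventStep {t : DTrace S E} {c c' : LowerSet E} {e : E}
    (h : t.EventStep c e c') {i : P} (hi : i ∈ S.loc (t.label e)) :
    t.view i (LowerSet.Iio e) = t.view i c := by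
  refine le_antisymm (t.view_mono i (Iio_le_of_eventStep h)) fun x hx => ?_
  obtain ⟨y, hy, hyi, hxy⟩ := t.mem_view.1 hx
  refine t.mem_view.2 ⟨y, ?_, hyi, hxy⟩
  have hye : y ∈ t.view i c' := t.mem_view_self (eventStep_le h hy) hyi
  rw [view_eventStep_of_mem h hi] at hye
  exact lt_of_le_of_ne hye fun hye => h.1 (hye ▸ hy)

theorem iSup_view_univ (t : DTrace S E) (c : LowerSet E) :
    ⨆ q ∈ (Set.univ : Set P), t.view q c = c := by
  apply le_antisymm
  · exact iSup₂_le fun q _ => t.view_le q c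
  · intro x hx
    obtain ⟨q, hq⟩ := S.loc_nonempty (t.label x)
    exact LowerSet.mem_iSup₂_iff.2 ⟨q, trivial, t.mem_view_self hx hq⟩

/-- The events known to `i` in a smaller configuration `d` are covered by those views in `d` that
are entirely known to `i`. For `e` maximal in `d ∩ view i c`, either `e` is the last event of `i`
in `c`, or `e` is covered in `view i c` by an event outside `d`; a process common to the two
events has `e` as its last event in `d`. -/
theorem exists_mem_view_le [Finite E] (t : DTrace S E) {c d : LowerSet E} (hdc : d ≤ c) {i : P}
    {e : E} (hec : e ∈ t.view i c) (hed : e ∈ d) :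
    ∃ m, e ∈ t.view m d ∧ t.view m d ≤ t.view i c := by
  obtain ⟨f, hef, hf⟩ := (Set.toFinite ((t.view i c ⊓ d : LowerSet E) : Set E)).exists_le_maximal
    (show e ∈ ((t.view i c ⊓ d : LowerSet E) : Set E) from ⟨hec, hed⟩)
  have hfi : f ∈ t.view i c := hf.1.1
  have hfd : f ∈ d := hf.1.2
  have hmax : ∀ y ∈ t.view i c, y ∈ d → f ≤ y → y ≤ f := fun y h1 h2 h3 => hf.2 ⟨h1, h2⟩ h3
  suffices H : ∃ m ∈ S.loc (t.label f), ∀ y ∈ d, m ∈ S.loc (t.label y) → y ≤ f by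
    obtain ⟨m, hm, H⟩ := H
    refine ⟨m, t.mem_view.2 ⟨f, hfd, hm, hef⟩, fun x hx => ?_⟩
    obtain ⟨y, hy, hym, hxy⟩ := t.mem_view.1 hx
    exact (t.view i c).lower (hxy.trans (H y hy hym)) hfi
  by_cases hcase : ∃ h ∈ t.view i c, f < h
  · obtain ⟨h', hh', hlt⟩ := hcase
    have : IsStronglyAtomic E := by
      have := Fintype.ofFinite E
      infer_instance
    obtain ⟨h, hfh, hhh'⟩ := exists_covBy_le_of_lt hlt
    have hh : h ∈ t.view i c := (t.view i c).lower hhh' hh'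
    obtain ⟨m, hm1, hm2⟩ := t.dep_of_covBy _ _ hfh
    refine ⟨m, hm1, fun y hy hym => ?_⟩
    rcases t.comparable_of_dep f y ⟨m, hm1, hym⟩ with h1 | h1
    · rcases t.comparable_of_dep y h ⟨m, hym, hm2⟩ with h2 | h2
      · exact hmax y ((t.view i c).lower h2 hh) hy h1
      · exact absurd (hmax h hh (d.lower h2 hy) hfh.le) hfh.lt.not_ge
    · exact h1
  · push Not at hcase
    obtain ⟨y, hy, hyi, hfy⟩ := t.mem_view.1 hfi
    obtain rfl : f = y := hfy.eq_of_not_lt (hcase y (t.mem_view_self hy hyi))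
    refine ⟨i, hyi, fun z hz hzi => ?_⟩
    rcases t.comparable_of_dep f z ⟨i, hyi, hzi⟩ with h | h
    · exact hmax z (t.mem_view_self (hdc hz) hzi) hz h
    · exact h

/-- Whether the view of `k` in `view i c` is known to `j` can be read off from the order of the
views in `view i c` and the views that `i` and `j` have in common. -/
theorem view_view_le_iff [Finite E] (t : DTrace S E) (c : LowerSet E) (i j k : P) :
    t.view k (t.view i c) ≤ t.view k (t.view j c) ↔
      t.view k (t.view i c) = ⊥ ∨ ∃ l m, t.view k (t.view i c) ≤ t.view l (t.view i c) ∧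
        t.view l (t.view i c) = t.view m (t.view j c) := by
  rw [view_le_view_iff]
  constructor
  · intro h
    rcases t.view_eq_bot_or_Iic k (t.view i c) with h0 | ⟨e, he, hk, h0⟩
    · exact Or.inl h0
    right
    have hej : e ∈ t.view j c := h (by rw [h0]; exact LowerSet.mem_Iic_iff.2 le_rfl)
    obtain ⟨f, hef, hf⟩ :=
      (Set.toFinite ((t.view i c ⊓ t.view j c : LowerSet E) : Set E)).exists_le_maximal
        (show e ∈ ((t.view i c ⊓ t.view j c : LowerSet E) : Set E) from ⟨he, hej⟩)
    have hfi : f ∈ t.view i c := hf.1.1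
    have hfj : f ∈ t.view j c := hf.1.2
    -- a view below the intersection that contains its maximal element `f` is generated by `f`
    have key : ∀ {m : P} {d : LowerSet E}, f ∈ t.view m d → t.view m d ≤ t.view i c →
        t.view m d ≤ t.view j c → t.view m d = LowerSet.Iic f := by
      intro m d h1 h2 h3
      rcases t.view_eq_bot_or_Iic m d with h4 | ⟨g, -, -, h4⟩
      · rw [h4] at h1; exact absurd h1 (by simp)
      · rw [h4] at h1 h2 h3 ⊢
        have hg : g ∈ LowerSet.Iic g := LowerSet.mem_Iic_iff.2 le_rfl
        rw [le_antisymm (hf.2 ⟨h2 hg, h3 hg⟩ h1) h1]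
    obtain ⟨m, hm1, hm2⟩ := t.exists_mem_view_le (t.view_le j c) hfi hfj
    obtain ⟨l, hl1, hl2⟩ := t.exists_mem_view_le (t.view_le i c) hfj hfi
    have em := key hm1 hm2 (t.view_le _ _)
    have el := key hl1 (t.view_le _ _) hl2
    exact ⟨l, m, by rw [h0, el]; exact LowerSet.Iic_le.2 hef, by rw [el, em]⟩
  · rintro (h | ⟨l, m, h1, h2⟩)
    · rw [h]; exact bot_le
    · exact h1.trans (h2 ▸ t.view_le _ _)

/-! ### The latest information -/

theorem exists_isLatest [LinearOrder P] [Finite P] (t : DTrace S E) {Q : Set P}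
    (hQ : Q.Nonempty) (c : LowerSet E) (j : P) : ∃ l, t.IsLatest Q c j l := by
  obtain ⟨m, hm⟩ := (Set.toFinite Q).exists_maximalFor (fun k => t.view j (t.view k c)) Q hQ
  have hne : {l | l ∈ Q ∧ ∀ k ∈ Q, t.view j (t.view k c) ≤ t.view j (t.view l c)}.Nonempty :=
    ⟨m, hm.1, fun k hk => (t.view_le_total j (t.view k c) (t.view m c)).elim id
      fun h => hm.2 hk h⟩
  obtain ⟨l, hl, h⟩ := Set.exists_min_image _ id (Set.toFinite _) hne
  exact ⟨l, hl, h⟩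

/-- The process with the latest information about `j` has the same view of `j` as all processes
of `Q` jointly. -/
theorem IsLatest.view_iSup [LinearOrder P] {t : DTrace S E} {Q : Set P} {c : LowerSet E} {j l : P}
    (h : t.IsLatest Q c j l) : t.view j (⨆ q ∈ Q, t.view q c) = t.view j (t.view l c) := by
  apply le_antisymm
  · intro x hx
    obtain ⟨y, hy, hj, hxy⟩ := t.mem_view.1 hx
    obtain ⟨q, hq, hy⟩ := LowerSet.mem_iSup₂_iff.1 hy
    exact h.1.2 q hq (t.mem_view.2 ⟨y, hy, hj, hxy⟩)
  · exact t.view_mono j (le_iSup₂_of_le l h.1.1 le_rfl)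

end DTrace

/-! ### Runs -/

namespace AsyncAutomaton

variable {P : Type u} {α : Type v} {S : DistributedAlphabet P α} {E : Type x} [PartialOrder E]

theorem Δ_apply_of_mem (A : AsyncAutomaton.{u, v, w} S) {a : α} (s : A.GlobalState) {i : P}
    (hi : i ∈ S.loc a) : A.Δ a s i = A.δ a (fun k => s k) ⟨i, hi⟩ := by
  simp [Δ, extendMap, hi]

theorem Δ_apply_of_notMem (A : AsyncAutomaton.{u, v, w} S) {a : α} (s : A.GlobalState) {i : P}
    (hi : i ∉ S.loc a) : A.Δ a s i = s i := by
  simp [Δ, extendMap, hi]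

section

variable [Finite E]

theorem run_eq_of_isRun (A : AsyncAutomaton.{u, v, w} S) {t : DTrace S E}
    {ρ : LowerSet E → A.GlobalState} (h : A.IsRun t ρ) : A.run t = ρ :=
  (A.existsUnique_isRun t).unique (A.isRun_run t) h

theorem run_eq_of_eventStep (A : AsyncAutomaton.{u, v, w} S) {t : DTrace S E}
    {ρ : LowerSet E → A.GlobalState} (hbot : ∀ i, ρ ⊥ i = A.init i)
    (hmem : ∀ c e c', t.EventStep c e c' → ∀ i (hi : i ∈ S.loc (t.label e)),
      ρ c' i = A.δ (t.label e) (fun k => ρ c k) ⟨i, hi⟩)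
    (hnotMem : ∀ c e c', t.EventStep c e c' → ∀ i ∉ S.loc (t.label e), ρ c' i = ρ c i) :
    A.run t = ρ := by
  refine A.run_eq_of_isRun ⟨funext hbot, ?_⟩
  rintro c _ c' ⟨e, rfl, h⟩
  funext i
  by_cases hi : i ∈ S.loc (t.label e)
  · rw [A.Δ_apply_of_mem _ hi, hmem c e c' h i hi]
  · rw [A.Δ_apply_of_notMem _ hi, hnotMem c e c' h i hi]

theorem run_bot (A : AsyncAutomaton.{u, v, w} S) (t : DTrace S E) : A.run t ⊥ = A.init :=
  (A.isRun_run t).1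

theorem run_eventStep (A : AsyncAutomaton.{u, v, w} S) {t : DTrace S E} {c c' : LowerSet E} {e : E}
    (h : t.EventStep c e c') : A.run t c' = A.Δ (t.label e) (A.run t c) :=
  ((A.isRun_run t).2 _ _ _ ⟨e, rfl, h⟩).symm

/-- The local state of `i` depends only on the view of `i`. -/
theorem run_view (A : AsyncAutomaton.{u, v, w} S) (t : DTrace S E) (c : LowerSet E) (i : P) :
    A.run t (t.view i c) i = A.run t c i := by
  induction c using LowerSet.strong_induction generalizing i with
  | h c ih =>
    rcases t.eq_bot_or_eventStep c with rfl | ⟨d, e, h⟩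
    · rw [t.view_bot]
    by_cases hi : i ∈ S.loc (t.label e)
    · rw [DTrace.view_eventStep_of_mem h hi, A.run_eventStep h,
        A.run_eventStep (t.eventStep_Iio e), A.Δ_apply_of_mem _ hi, A.Δ_apply_of_mem _ hi]
      congr 1
      funext k
      have hd := DTrace.lt_of_eventStep h
      rw [← ih d hd k, ← ih _ ((DTrace.Iio_le_of_eventStep h).trans_lt hd) k,
        DTrace.view_Iio_of_eventStep h k.2]
    · rw [DTrace.view_eventStep_of_notMem h hi, A.run_eventStep h, A.Δ_apply_of_notMem _ hi]
      exact ih d (DTrace.lt_of_eventStep h) i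

end

end AsyncAutomaton

/-! ### The gossip-augmented automaton and cascade products -/

namespace AsyncAutomaton

variable {P : Type u} [LinearOrder P] {α : Type v} {S : DistributedAlphabet P α}
  {G : AsyncAutomaton.{u, v, y} S} {gossip : G.GossipFamily}

/-- The function `globalstate` computes the state of `A` at the joint view of the processes in
`Q`, if each of them knows the state of `A` at its own view. -/
theorem globalstateOn_view (hG : IsGossip.{u, v, x, y} G gossip) (A : AsyncAutomaton.{u, v, w} S)
    {E : Type x} [PartialOrder E] [Finite E] (t : DTrace S E) (c : LowerSet E) {Q : Set P}
    (hQ : Q.Nonempty) :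
    globalstateOn G gossip A Q hQ (fun i => (G.run t c i, A.run t (t.view i c))) =
      A.run t (⨆ q ∈ Q, t.view q c) := by
  funext i
  have h := (hG E t c Q hQ i).view_iSup
  rw [← A.run_view t _ i, h, A.run_view]
  rfl

variable [Finite P]

/-- In the gossip-augmented automaton, every process knows the state of `A` at its own view. -/
theorem run_augment (hG : IsGossip.{u, v, x, y} G gossip) (A : AsyncAutomaton.{u, v, w} S)
    {E : Type x} [PartialOrder E] [Finite E] (t : DTrace S E) :
    (augment G gossip A).run t = fun c i => (G.run t c i, A.run t (t.view i c)) := by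
  refine run_eq_of_eventStep _ (fun i => ?_) (fun c e c' h i hi => ?_) fun c e c' h i hi => ?_
  · refine Prod.ext (congrFun (G.run_bot t) i) ?_
    change A.run t (t.view i ⊥) = A.init
    rw [t.view_bot, A.run_bot]
  · refine Prod.ext ?_ ?_
    · change G.run t c' i = _
      rw [G.run_eventStep h, G.Δ_apply_of_mem _ hi]
      rfl
    · change A.run t (t.view i c') = A.Δ (t.label e) (globalstateOn G gossip A _ _ _)
      rw [globalstateOn_view hG A t c (S.loc_nonempty _), DTrace.iSup_view_eventStep h,
        DTrace.view_eventStep_of_mem h hi, A.run_eventStep (t.eventStep_Iio e)]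
  · change (G.run t c' i, A.run t (t.view i c')) = (G.run t c i, A.run t (t.view i c))
    rw [G.run_eventStep h, G.Δ_apply_of_notMem _ hi, DTrace.view_eventStep_of_notMem h hi]

theorem globalstate_run_augment (hG : IsGossip.{u, v, x, y} G gossip)
    (A : AsyncAutomaton.{u, v, w} S) {E : Type x} [PartialOrder E] [Finite E] {t : DTrace S E}
    {c c' : LowerSet E} {e : E} (h : t.EventStep c e c') :
    globalstate G gossip A ⟨t.label e, fun i => (augment G gossip A).run t c i⟩ =
      (t.label e, A.run t (LowerSet.Iio e)) := by
  rw [run_augment hG, ← DTrace.iSup_view_eventStep h,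
    ← globalstateOn_view hG A t c (S.loc_nonempty _)]
  rfl

theorem run_localCascade (hG : IsGossip.{u, v, x, y} G gossip) (A : AsyncAutomaton.{u, v, w} S)
    (B : AsyncAutomaton.{u, max u v w, z} A.globalAlphabet)
    {E : Type x} [PartialOrder E] [Finite E] (t : DTrace S E) :
    ((augment G gossip A).localCascade (viaGlobalstate G gossip A B)).run t =
      fun c i => ((augment G gossip A).run t c i, B.run (A.globalTransducer t) c i) := by
  refine run_eq_of_eventStep _ (fun i => ?_) (fun c e c' h i hi => ?_) fun c e c' h i hi => ?_
  · exact Prod.ext (congrFun (run_bot _ t) i) (congrFun (B.run_bot _) i)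
  · refine Prod.ext ?_ ?_
    · change (augment G gossip A).run t c' i = _
      rw [run_eventStep _ h, Δ_apply_of_mem _ _ hi]
      rfl
    · -- `B.δ` has a type depending on the letter, so equal letters are substituted here
      have key : ∀ b b' : A.GlobalLetter, b = b' → ∀ (s : B.GlobalState)
          (h1 : i ∈ A.globalAlphabet.loc b) (h2 : i ∈ A.globalAlphabet.loc b'),
          B.δ b (fun k => s k) ⟨i, h1⟩ = B.δ b' (fun k => s k) ⟨i, h2⟩ := by
        rintro b _ rfl s h1 h2
        rfl
      have hB : (A.globalTransducer t).EventStep c e c' := h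
      have hi' : i ∈ A.globalAlphabet.loc ((A.globalTransducer t).label e) := hi
      change B.run (A.globalTransducer t) c' i = _
      rw [B.run_eventStep hB, B.Δ_apply_of_mem _ hi']
      exact key _ _ (globalstate_run_augment hG A h).symm _ hi' hi
  · have hB : (A.globalTransducer t).EventStep c e c' := h
    have hi' : i ∉ A.globalAlphabet.loc ((A.globalTransducer t).label e) := hi
    refine Prod.ext ?_ ?_
    · change (augment G gossip A).run t c' i = (augment G gossip A).run t c i
      rw [run_eventStep _ h, Δ_apply_of_notMem _ _ hi]
    · change B.run (A.globalTransducer t) c' i = B.run (A.globalTransducer t) c i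
      rw [B.run_eventStep hB, B.Δ_apply_of_notMem _ hi']

/-- The global state of `A`, computed from the local states of all processes. Without processes
there is only one global state. -/
theorem exists_globalstate_univ (hG : IsGossip.{u, v, x, y} G gossip)
    (A : AsyncAutomaton.{u, v, w} S) :
    ∃ π : (augment G gossip A).GlobalState → A.GlobalState,
      ∀ (E : Type x) [PartialOrder E] [Finite E] (t : DTrace S E) (c : LowerSet E),
        π ((augment G gossip A).run t c) = A.run t c := by
  rcases isEmpty_or_nonempty P with hP | hP
  · exact ⟨fun _ => A.init, fun E _ _ t c => funext fun i => (hP.false i).elim⟩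
  · refine ⟨fun r => globalstateOn G gossip A Set.univ Set.univ_nonempty fun i => r i,
      fun E _ _ t c => ?_⟩
    rw [run_augment hG]
    exact (globalstateOn_view hG A t c Set.univ_nonempty).trans (by rw [t.iSup_view_univ])

end AsyncAutomaton

/-! ### Construction of a gossip automaton -/

/-- Labels of events: a process taking part in the event and one of `|P|³ + 1` names. -/
abbrev GossipLabel (P : Type u) : Type u := P × Option (P × P × P)

/-- The local states of the gossip automaton. At a configuration `c`, the local state of `i`
consists of the labels (at `j k`) of the last event of `k` in the view of `j` in the view of `i`,
and of the inclusion relation (at `k l`) between the views of `k` and `l` in the view of `i`. -/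
abbrev GossipData (P : Type u) : Type u := (P → P → Option (GossipLabel P)) × (P → P → Prop)

namespace GossipData

variable {P : Type u}

/-- The view of `k` in the view of the owner of `x` is known to the owner of `y`, judging by
the labels. -/
def Known (x y : GossipData P) (k : P) : Prop :=
  x.1 k k = none ∨ ∃ l m, x.2 k l ∧ x.1 l l = y.1 m m

/-- The least member of `Q` with the best information about `j`, judging by the labels, and some
member of `Q` if there is no such process. -/
noncomputable def latest [LinearOrder P] (Q : Set P) (hQ : Q.Nonempty) (s : Q → GossipData P)
    (j : P) : Q :=
  open Classical in
  if h : ∃ l, IsLeast {l | ∀ k, Known (s k) (s l) j} l then h.choose else ⟨_, hQ.some_mem⟩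

theorem exists_fresh [Finite P] (p : P) {Q : Set P} (s : Q → GossipData P) :
    ∃ n : Option (P × P × P), ∀ q j k, (s q).1 j k ≠ some (p, n) := by
  by_contra! h
  choose q j k h using h
  -- otherwise `|P|³ + 1` names would occur at distinct places `q j k`, of which there are `|P|³`
  have hinj : Function.Injective fun n => ((q n : P), j n, k n) := by
    intro n n' hn
    simp only [Prod.mk.injEq, Subtype.coe_inj] at hn
    obtain ⟨h1, h2, h3⟩ := hn
    have := h n
    rw [h1, h2, h3, h n'] at this
    simpa using this.symm
  have := Fintype.ofFinite P
  have := Fintype.card_le_of_injective _ hinj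
  rw [Fintype.card_option] at this
  omega

/-- The label given to an event with participants `Q` in the states `s`: it occurs in no state
of a participant. -/
noncomputable def newLabel [Finite P] (Q : Set P) (hQ : Q.Nonempty) (s : Q → GossipData P) :
    GossipLabel P :=
  (hQ.some, (exists_fresh hQ.some s).choose)

theorem ne_newLabel [Finite P] {Q : Set P} (hQ : Q.Nonempty) (s : Q → GossipData P) (q : Q)
    (j k : P) : (s q).1 j k ≠ some (newLabel Q hQ s) :=
  (exists_fresh hQ.some s).choose_spec q j k

open Classical in
/-- The label of the last event of `k` after an event with participants `Q` in the states `s`. -/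
noncomputable def lastLabel [Finite P] [LinearOrder P] (Q : Set P) (hQ : Q.Nonempty)
    (s : Q → GossipData P) (k : P) : Option (GossipLabel P) :=
  if k ∈ Q then some (newLabel Q hQ s) else (s (latest Q hQ s k)).1 k k

open Classical in
/-- The common state of all participants `Q` after an event, where `s` are their states before
the event. The last event of `k ∉ Q` is the one known to the participant with the latest
information about `k`. -/
noncomputable def update [Finite P] [LinearOrder P] (Q : Set P) (hQ : Q.Nonempty)
    (s : Q → GossipData P) : GossipData P :=
  (fun j k => if j ∈ Q then lastLabel Q hQ s k else (s (latest Q hQ s j)).1 j k,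
   fun k l => l ∈ Q ∨ k ∉ Q ∧ (s (latest Q hQ s k)).1 k k = (s (latest Q hQ s l)).1 k k ∧
      (s (latest Q hQ s l)).2 k l)

end GossipData

/-- The gossip automaton. -/
noncomputable def gossipAutomaton {P : Type u} [Finite P] [LinearOrder P] {α : Type v}
    (S : DistributedAlphabet P α) : AsyncAutomaton.{u, v, u} S where
  State _ := GossipData P
  finite_state _ := inferInstance
  nonempty_state _ := inferInstance
  δ a s _ := GossipData.update (S.loc a) (S.loc_nonempty a) s
  init _ := (fun _ _ => none, fun _ _ => True)

namespace DTrace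

variable {P : Type u} {α : Type v} {S : DistributedAlphabet P α} {E : Type x} [PartialOrder E]

open Classical in
/-- The label, under `f`, of the greatest element of `X`, and `none` if there is none. -/
noncomputable def _root_.LowerSet.topLabel {L : Type*} (f : E → L) (X : LowerSet E) : Option L :=
  if h : ∃ e, X = LowerSet.Iic e then some (f h.choose) else none

theorem _root_.LowerSet.topLabel_Iic {L : Type*} (f : E → L) (e : E) :
    (LowerSet.Iic e).topLabel f = some (f e) := by
  have h : ∃ e', LowerSet.Iic e = LowerSet.Iic e' := ⟨e, rfl⟩
  rw [LowerSet.topLabel, dif_pos h, ← LowerSet.Iic_injective h.choose_spec]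

theorem _root_.LowerSet.topLabel_bot {L : Type*} (f : E → L) :
    (⊥ : LowerSet E).topLabel f = none := by
  rw [LowerSet.topLabel, dif_neg]
  rintro ⟨e, he⟩
  have : e ∈ (⊥ : LowerSet E) := he ▸ LowerSet.mem_Iic_iff.2 le_rfl
  exact this

theorem topLabel_view_eq_none [Finite E] {L : Type*} {f : E → L} (t : DTrace S E) {j : P}
    {c : LowerSet E} : (t.view j c).topLabel f = none ↔ t.view j c = ⊥ := by
  rcases t.view_eq_bot_or_Iic j c with h | ⟨e, -, -, h⟩
  · simp [h, LowerSet.topLabel_bot]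
  · rw [h, LowerSet.topLabel_Iic]
    simp only [reduceCtorEq, false_iff]
    intro h'
    have : e ∈ (⊥ : LowerSet E) := h' ▸ LowerSet.mem_Iic_iff.2 le_rfl
    exact this

variable [Finite P] [LinearOrder P] [Finite E]

/-- The label that the gossip automaton gives to the event `e`. -/
noncomputable def gossipLabel (t : DTrace S E) (e : E) : GossipLabel P :=
  GossipData.newLabel (S.loc (t.label e)) (S.loc_nonempty _)
    fun i => (gossipAutomaton S).run t (LowerSet.Iio e) i

/-- The intended state of the process `i` at the configuration `c`. -/
noncomputable def gossipData (t : DTrace S E) (c : LowerSet E) (i : P) : GossipData P :=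
  (fun j k => (t.view k (t.view j (t.view i c))).topLabel t.gossipLabel,
   fun k l => t.view k (t.view i c) ≤ t.view l (t.view i c))

/-- The gossip automaton is in the intended states at the configuration `c`. -/
def GossipCorrect (t : DTrace S E) (c : LowerSet E) : Prop :=
  ∀ i, (gossipAutomaton S).run t c i = t.gossipData c i

/-- Among the last events of processes in the views of processes, the labels are unique. If `e < f`
had the same label, then they share a process, and since `e` is still the last event of some process
in some view, the participants of `f` know its label when they choose that of `f`. -/
theorem view_eq_of_topLabel_eq {t : DTrace S E} {c : LowerSet E}
    (H : ∀ f ∈ c, t.GossipCorrect (LowerSet.Iio f)) {i j k l : P}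
    (h : (t.view k (t.view i c)).topLabel t.gossipLabel =
      (t.view l (t.view j c)).topLabel t.gossipLabel) :
    t.view k (t.view i c) = t.view l (t.view j c) := by
  have aux : ∀ {i k : P} {e f : E}, t.view k (t.view i c) = LowerSet.Iic e →
      k ∈ S.loc (t.label e) → f ∈ c → t.gossipLabel e = t.gossipLabel f → ¬ e < f := by
    intro i k e f he hk hf hl hlt
    have hei : e ∈ t.view i c := t.view_le k _ (he ▸ LowerSet.mem_Iic_iff.2 le_rfl)
    have hfc : LowerSet.Iio f ≤ c := fun x hx => c.lower (le_of_lt hx) hf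
    obtain ⟨m, hm1, hm2⟩ := t.exists_mem_view_le hfc hei hlt
    obtain ⟨q, hq⟩ := t.exists_isLatest (S.loc_nonempty (t.label f)) (LowerSet.Iio f) m
    have hv := hq.view_iSup
    rw [iSup_view_eventStep (t.eventStep_Iio f)] at hv
    have hkm : t.view k (t.view m (t.view q (LowerSet.Iio f))) = LowerSet.Iic e := by
      rw [← hv]
      apply le_antisymm
      · rw [← he]; exact t.view_mono k hm2
      · intro x hx
        exact t.mem_view.2 ⟨e, hm1, hk, hx⟩
    refine GossipData.ne_newLabel (S.loc_nonempty (t.label f))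
      (fun i => (gossipAutomaton S).run t (LowerSet.Iio f) i) ⟨q, hq.1.1⟩ m k ?_
    change ((gossipAutomaton S).run t (LowerSet.Iio f) q).1 m k = some (t.gossipLabel f)
    rw [H f hf q, ← hl]
    change LowerSet.topLabel _ (t.view k (t.view m (t.view q (LowerSet.Iio f)))) = _
    rw [hkm, LowerSet.topLabel_Iic]
  rcases t.view_eq_bot_or_Iic k (t.view i c) with h1 | ⟨e, he, hke, h1⟩
  · rw [h1, LowerSet.topLabel_bot, eq_comm, topLabel_view_eq_none] at h
    rw [h1, h]
  rcases t.view_eq_bot_or_Iic l (t.view j c) with h2 | ⟨f, hf, hlf, h2⟩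
  · rw [h2, LowerSet.topLabel_bot, topLabel_view_eq_none] at h
    rw [h2, h]
  rw [h1, h2, LowerSet.topLabel_Iic, LowerSet.topLabel_Iic, Option.some_inj] at h
  have hdep : S.Dep (t.label e) (t.label f) := by
    refine ⟨(t.gossipLabel e).1, (S.loc_nonempty (t.label e)).some_mem, ?_⟩
    rw [h]
    exact (S.loc_nonempty (t.label f)).some_mem
  have he' := t.view_le i c he
  have hf' := t.view_le j c hf
  have hef : e = f := by
    rcases t.comparable_of_dep e f hdep with hle | hle
    · exact hle.eq_of_not_lt (aux h1 hke hf' h)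
    · exact (hle.eq_of_not_lt (aux h2 hlf he' h.symm)).symm
  rw [h1, h2, hef]

theorem known_gossipData_iff {t : DTrace S E} {c : LowerSet E}
    (H : ∀ f ∈ c, t.GossipCorrect (LowerSet.Iio f)) (i j k : P) :
    GossipData.Known (t.gossipData c i) (t.gossipData c j) k ↔
      t.view k (t.view i c) ≤ t.view k (t.view j c) := by
  simp only [GossipData.Known, gossipData, view_view_self]
  rw [view_view_le_iff, topLabel_view_eq_none]
  refine or_congr_right (exists_congr fun l => exists_congr fun m => and_congr_right fun _ => ?_)
  exact ⟨view_eq_of_topLabel_eq H, fun h => by rw [h]⟩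

theorem isLatest_latest {t : DTrace S E} {c : LowerSet E}
    (H : ∀ f ∈ c, t.GossipCorrect (LowerSet.Iio f)) {Q : Set P} (hQ : Q.Nonempty) (j : P) :
    t.IsLatest Q c j (GossipData.latest Q hQ (fun i => t.gossipData c i) j) := by
  obtain ⟨l, hl⟩ := t.exists_isLatest hQ c j
  have h : ∃ l : Q, IsLeast {l : Q | ∀ k : Q,
      GossipData.Known (t.gossipData c k) (t.gossipData c l) j} l := by
    refine ⟨⟨l, hl.1.1⟩, fun k => ?_, fun k hk => hl.2 ⟨k.2, fun m hm => ?_⟩⟩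
    · exact (known_gossipData_iff H _ _ _).2 (hl.1.2 k k.2)
    · exact (known_gossipData_iff H _ _ _).1 (hk ⟨m, hm⟩)
  have hs := h.choose_spec
  rw [GossipData.latest, dif_pos h]
  refine ⟨⟨h.choose.2, fun k hk => (known_gossipData_iff H _ _ _).1 (hs.1 ⟨k, hk⟩)⟩, ?_⟩
  intro k hk
  have hk' : (⟨k, hk.1⟩ : Q) ∈ {l : Q | ∀ k : Q,
      GossipData.Known (t.gossipData c k) (t.gossipData c l) j} := fun m =>
    (known_gossipData_iff H _ _ _).2 (hk.2 m m.2)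
  exact hs.2 hk'

theorem gossipData_bot (t : DTrace S E) (i : P) :
    t.gossipData ⊥ i = (fun _ _ => none, fun _ _ => True) := by
  simp [gossipData, view_bot, LowerSet.topLabel_bot]

theorem gossipData_eventStep {t : DTrace S E} {c c' : LowerSet E} {e : E}
    (h : t.EventStep c e c') (H : ∀ f ∈ c', t.GossipCorrect (LowerSet.Iio f)) {i : P}
    (hi : i ∈ S.loc (t.label e)) :
    t.gossipData c' i = GossipData.update (S.loc (t.label e)) (S.loc_nonempty _)
      fun i => t.gossipData c i := by
  classical
  have Hc : ∀ f ∈ c, t.GossipCorrect (LowerSet.Iio f) := fun f hf => H f (eventStep_le h hf)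
  set Q := S.loc (t.label e)
  set p : P → Q := GossipData.latest Q (S.loc_nonempty _) (fun i => t.gossipData c i) with hp
  have hlat : ∀ k, t.IsLatest Q c k (p k) := fun k => isLatest_latest Hc (S.loc_nonempty _) k
  have hview : ∀ k ∉ Q, t.view k (LowerSet.Iic e) = t.view k (t.view (p k) c) := fun k hk => by
    rw [view_eventStep_of_notMem (t.eventStep_Iio e) hk, ← iSup_view_eventStep h,
      (hlat k).view_iSup]
  have hnew : GossipData.newLabel Q (S.loc_nonempty _) (fun i => t.gossipData c i) =
      t.gossipLabel e := by
    rw [gossipLabel]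
    congr 1
    funext q
    rw [H e ((mem_of_eventStep h).2 (Or.inr rfl)) q, gossipData, gossipData,
      view_Iio_of_eventStep h q.2]
  have hlast : ∀ k, (t.view k (LowerSet.Iic e)).topLabel t.gossipLabel =
      GossipData.lastLabel Q (S.loc_nonempty _) (fun i => t.gossipData c i) k := by
    intro k
    rw [GossipData.lastLabel]
    split_ifs with hk
    · rw [t.view_Iic hk, LowerSet.topLabel_Iic, hnew]
    · rw [hview k hk, ← hp]
      simp only [gossipData, view_view_self]
  rw [gossipData, view_eventStep_of_mem h hi, GossipData.update]
  refine Prod.ext ?_ ?_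
  · funext j k
    dsimp only
    split_ifs with hj
    · rw [t.view_Iic hj, hlast]
    · rw [hview j hj, ← hp]
      rfl
  · funext k l
    apply propext
    change _ ↔ l ∈ Q ∨ k ∉ Q ∧ (t.gossipData c (p k)).1 k k = (t.gossipData c (p l)).1 k k ∧
      (t.gossipData c (p l)).2 k l
    by_cases hl : l ∈ Q
    · simp only [hl, true_or, iff_true]
      rw [t.view_Iic hl]
      exact t.view_le _ _
    simp only [hl, false_or]
    by_cases hk : k ∈ Q
    · simp only [hk, not_true_eq_false, false_and, iff_false]
      rw [t.view_Iic hk, view_eventStep_of_notMem (t.eventStep_Iio e) hl]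
      intro hle
      exact lt_irrefl e (t.view_le _ _ (hle (LowerSet.mem_Iic_iff.2 le_rfl)))
    simp only [hk, not_false_eq_true, true_and, gossipData, view_view_self]
    rw [hview k hk, hview l hl]
    constructor
    · intro hle
      have heq : t.view k (t.view (p k) c) = t.view k (t.view (p l) c) :=
        le_antisymm (t.view_le_view_iff.2 (hle.trans (t.view_le _ _)))
          ((hlat k).1.2 _ (p l).2)
      exact ⟨by rw [heq], heq ▸ hle⟩
    · rintro ⟨h1, h2⟩
      rw [view_eq_of_topLabel_eq Hc h1]
      exact h2

theorem gossipCorrect (t : DTrace S E) (c : LowerSet E) : t.GossipCorrect c := by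
  induction c using LowerSet.strong_induction with
  | h c ih =>
    intro i
    rcases t.eq_bot_or_eventStep c with rfl | ⟨d, e, h⟩
    · rw [AsyncAutomaton.run_bot, gossipData_bot]
      rfl
    have hd := lt_of_eventStep h
    have H : ∀ f ∈ c, t.GossipCorrect (LowerSet.Iio f) := fun f hf =>
      ih _ (lt_of_le_of_ne (fun x hx => c.lower (le_of_lt hx) hf)
        fun hfc => lt_irrefl f (show f ∈ LowerSet.Iio f from hfc ▸ hf))
    rw [AsyncAutomaton.run_eventStep _ h]
    by_cases hi : i ∈ S.loc (t.label e)
    · rw [AsyncAutomaton.Δ_apply_of_mem _ _ hi, gossipData_eventStep h H hi,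
        ← funext fun k : S.loc (t.label e) => ih d hd k]
      rfl
    · rw [AsyncAutomaton.Δ_apply_of_notMem _ _ hi, ih d hd i, gossipData, gossipData,
        view_eventStep_of_notMem h hi]

end DTrace

namespace AsyncAutomaton

variable {P : Type u} [LinearOrder P] {α : Type v}

theorem isGossip_gossipAutomaton [Finite P] (S : DistributedAlphabet P α) :
    IsGossip.{u, v, x, u} (gossipAutomaton S) GossipData.latest := by
  intro E _ _ t c Q hQ j
  have h := DTrace.isLatest_latest (t := t) (c := c) (fun f _ => t.gossipCorrect _) hQ j
  rw [← funext fun k : Q => t.gossipCorrect c k] at h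
  exact h

/-- As local states are finite sets, they can be moved to any universe. -/
theorem IsGossip.exists_universe_zero {S : DistributedAlphabet P α}
    {G : AsyncAutomaton.{u, v, y} S} {gossip : G.GossipFamily}
    (hG : IsGossip.{u, v, x, y} G gossip) :
    ∃ (G' : AsyncAutomaton.{u, v, 0} S) (gossip' : G'.GossipFamily),
      IsGossip.{u, v, x, 0} G' gossip' := by
  have := G.finite_state
  have := G.nonempty_state
  let f (i : P) : G.State i ≃ Fin (Nat.card (G.State i)) := Finite.equivFin _
  let G' : AsyncAutomaton.{u, v, 0} S :=
    { State := fun i => Fin (Nat.card (G.State i))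
      finite_state := fun _ => inferInstance
      nonempty_state := fun i => ⟨f i (G.init i)⟩
      δ := fun a s i => f i (G.δ a (fun k => (f k).symm (s k)) i)
      init := fun i => f i (G.init i) }
  refine ⟨G', fun Q hQ s j => gossip Q hQ (fun k => (f k).symm (s k)) j, ?_⟩
  intro E _ _ t c Q hQ j
  have hrun : G'.run t = fun c i => f i (G.run t c i) := by
    refine run_eq_of_eventStep _ (fun i => ?_) (fun c e c' h i hi => ?_) fun c e c' h i hi => ?_
    · rw [G.run_bot]
    · rw [G.run_eventStep h, G.Δ_apply_of_mem _ hi]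
      simp [G']
    · rw [G.run_eventStep h, G.Δ_apply_of_notMem _ hi]
  simpa [hrun] using hG E t c Q hQ j

end AsyncAutomaton

open AsyncAutomaton in
theorem mainTheorem7 {P : Type u} [Finite P] [LinearOrder P] {α : Type v}
    (S : DistributedAlphabet P α) :
    -- a gossip automaton (with finite sets of local states) exists
    (∃ (G : AsyncAutomaton.{u, v, 0} S) (gossip : G.GossipFamily),
      IsGossip.{u, v, x, 0} G gossip) ∧
    -- and, for every gossip automaton and every automaton `A`:
    ∀ (G : AsyncAutomaton.{u, v, y} S) (gossip : G.GossipFamily), IsGossip.{u, v, x, y} G gossip →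
      ∀ A : AsyncAutomaton.{u, v, w} S,
        -- the global transducer is the relabelling by `globalstate` of the local transducer
        (∀ (E : Type x) [PartialOrder E] [Finite E] (t : DTrace S E) (e : E),
          (A.globalTransducer t).label e =
            globalstate G gossip A (((augment G gossip A).localTransducer t).label e)) ∧
        -- and global cascade products with `A` are simulated by local cascade products
        ∀ B : AsyncAutomaton.{u, max u v w, z} A.globalAlphabet,
          ∃ π : (augment G gossip A).GlobalState → A.GlobalState,
            (∀ (E : Type x) [PartialOrder E] [Finite E] (t : DTrace S E) (c : LowerSet E),
              globalCascadeRun A B t c =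
                (π (fun i => (((augment G gossip A).localCascade
                      (viaGlobalstate G gossip A B)).run t c i).1),
                  fun i => (((augment G gossip A).localCascade
                      (viaGlobalstate G gossip A B)).run t c i).2)) ∧
            ∀ F : Set (A.GlobalState × B.GlobalState),
              ∃ F' : Set ((augment G gossip A).localCascade
                  (viaGlobalstate G gossip A B)).GlobalState,
                ∀ (E : Type x) [PartialOrder E] [Finite E] (t : DTrace S E),
                  globalCascadeRun A B t ⊤ ∈ F ↔
                    ((augment G gossip A).localCascade
                      (viaGlobalstate G gossip A B)).run t ⊤ ∈ F' := by
  refine ⟨(isGossip_gossipAutomaton S).exists_universe_zero, fun G gossip hG A => ⟨?_, ?_⟩⟩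
  · intro E _ _ t e
    exact (globalstate_run_augment hG A (t.eventStep_Iio e)).symm
  · intro B
    obtain ⟨π, hπ⟩ := exists_globalstate_univ hG A
    have hsim : ∀ (E : Type x) [PartialOrder E] [Finite E] (t : DTrace S E) (c : LowerSet E),
        globalCascadeRun A B t c =
          (π (fun i => (((augment G gossip A).localCascade
                (viaGlobalstate G gossip A B)).run t c i).1),
            fun i => (((augment G gossip A).localCascade
                (viaGlobalstate G gossip A B)).run t c i).2) := by
      intro E _ _ t c
      rw [run_localCascade hG A B t]
      exact Prod.ext (hπ E t c).symm rfl
    refine ⟨π, hsim, fun F => ⟨{r | (π fun i => (r i).1, fun i => (r i).2) ∈ F}, ?_⟩⟩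
    intro E _ _ t
    rw [hsim E t ⊤]
    rfl
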